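/- Let $\Delta_D$ be the square complex with one vertex, two vertical loops $a,b$, two horizontal loops $x,y$, and four squares, attached along the closed paths that give the relations $$ax=yb,\qquad ay=y^{-1}b,\qquad bx=xa^{-1},\qquad by=x^{-1}a,$$ so that $\pi_1(\Delta_D)=\langle a,b,x,y\mid ax=yb,\ ay=y^{-1}b,\ bx=xa^{-1},\ by=x^{-1}a\rangle$. This complex is complete: for every $s\in S=\{a,b,a^{-1},b^{-1}\}$ and every $z\in X=\{x,y,x^{-1},y^{-1}\}$ exactly one corner of one square has sides $s$ and $z$, so there is exactly one relation $sz=wt$ with $w\in X$, $t\in S$ among the sixteen relations $$sz=wt,\qquad s^{-1}w=zt^{-1},\qquad tz^{-1}=w^{-1}s,\qquad t^{-1}w^{-1}=z^{-1}s^{-1}$$ read off the four squares $sz=wt$ above. Let $A$ be the associated Mealy automaton with state set $S$ and alphabet $X$ (eight distinct symbols), which in state $s$ reads $z$, outputs $w$ and passes to state $t$ whenever $sz=wt$ is one of these relations. Let $\partial A$ be its dual, with state set $X$ and alphabet $S$, which in state $z$ reads $s$, outputs $t$ and passes to state $w$ for the same relations. For an automaton whose states act on finite words over the alphabet by bijections,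 its automaton group is the quotient of the free group on the set of states by the kernel of its action on the set of finite words. Let $G_A$ and $G_{\partial A}$ be the automaton groups of $A$ and $\partial A$. Then $A$ is bireversible (that is, in the set of all transitions $sz=wt$ of $A$, each of the pairs $(s,w)$, $(t,z)$, $(t,w)$ takes every value in $S\times X$ exactly once), and: 1. $\pi_1(\Delta_D)$ is not residually finite; 2. $G_A\cong C_3*C_3$ and $G_{\partial A}\cong F_2$, where $C_3$ is the cyclic group of order three, $*$ is the free product, and $F_2$ is the free group of rank two. -/

import Mathlib

/-! ### Mealy automata and automaton groups -/

/-- A complete deterministic automaton-transducer `(S, X, lam)` with state set `S` and alphabet `X`: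
`trans (s, x) = (y, t)` means that in state `s` the automaton reads `x`, outputs `y` and passes to
the state `t`. This is the arrow `s --x|y--> t`. -/
structure Mealy (S X : Type*) where
  trans : S × X → X × S

namespace Mealy

variable {S X : Type*}

/-- There is an arrow `s --x|y--> t`. -/
def Arrow (A : Mealy S X) (s : S) (x y : X) (t : S) : Prop := A.trans (s, x) = (y, t)

/-- The dual automaton: `x --s|t--> y` is an arrow of the dual iff `s --x|y--> t` is an arrow
of `A`. (The letters are not decorated with formal inverses, which only renames the states and
the alphabet.) -/
def dual (A : Mealy S X) : Mealy X S where
  trans p := ((A.trans (p.2, p.1)).2, (A.trans (p.2, p.1)).1)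

/-- `A` is invertible: the inverse automaton, with arrows `s⁻¹ --y|x--> t⁻¹` for the arrows
`s --x|y--> t` of `A`, is complete and deterministic. -/
def IsInvertible (A : Mealy S X) : Prop :=
  ∀ (s : S) (y : X), ∃! p : X × S, A.Arrow s p.1 y p.2

/-- `A` is bireversible: the automata obtained from `A` by iterating inversion and dualization are
complete and deterministic. Up to duality, which preserves these two properties, and up to names,
they have the arrows `s --x|y--> t`, `s --y|x--> t`, `x --t|s--> y` and `y --t|s--> x`, one for
every arrow `s --x|y--> t` of `A`. The first family is `A` itself. -/
def IsBireversible (A : Mealy S X) : Prop :=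
  (∀ (s : S) (y : X), ∃! p : X × S, A.Arrow s p.1 y p.2) ∧
  (∀ (x : X) (t : S), ∃! p : S × X, A.Arrow p.1 x p.2 t) ∧
  (∀ (y : X) (t : S), ∃! p : S × X, A.Arrow p.1 p.2 y t)

theorem IsBireversible.isInvertible {A : Mealy S X} (h : A.IsBireversible) : A.IsInvertible := h.1

theorem IsBireversible.dual_isInvertible {A : Mealy S X} (h : A.IsBireversible) :
    A.dual.IsInvertible := by
  intro x t
  obtain ⟨⟨s, y⟩, hp, hu⟩ := h.2.1 x t
  refine ⟨(s, y), ?_, ?_⟩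
  · simp only [Arrow] at hp
    simp [Arrow, dual, hp]
  · rintro ⟨s', y'⟩ h'
    simp only [Arrow, dual, Prod.mk.injEq] at h'
    exact hu (s', y') (Prod.ext h'.2 h'.1)

/-- The transformation of words over `X` defined by a state `s`. -/
def act (A : Mealy S X) : S → List X → List X
  | _, [] => []
  | s, x :: w => (A.trans (s, x)).1 :: A.act (A.trans (s, x)).2 w

theorem act_bijective (A : Mealy S X) (h : A.IsInvertible) (s : S) :
    Function.Bijective (A.act s) := by
  constructor
  · intro u
    induction u generalizing s with
    | nil => intro v hv; cases v <;> simp_all [act]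
    | cons x u ih =>
      intro v hv
      cases v with
      | nil => simp [act] at hv
      | cons z v =>
        simp only [act, List.cons.injEq] at hv
        have e : (x, (A.trans (s, x)).2) = (z, (A.trans (s, z)).2) :=
          (h s (A.trans (s, x)).1).unique (y₁ := (x, (A.trans (s, x)).2))
            (y₂ := (z, (A.trans (s, z)).2)) rfl (Prod.ext hv.1.symm rfl)
        obtain rfl : x = z := congrArg Prod.fst e
        rw [ih _ hv.2]
  · intro v
    induction v generalizing s with
    | nil => exact ⟨[], rfl⟩
    | cons y v ih =>
      obtain ⟨⟨x, t⟩, hp, -⟩ := h s y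
      obtain ⟨u, hu⟩ := ih t
      simp only [Arrow] at hp
      exact ⟨x :: u, by simp [act, hp, hu]⟩

/-- The transformation defined by a state of an invertible automaton, as a permutation of the set
of words. -/
noncomputable def statePerm (A : Mealy S X) (h : A.IsInvertible) (s : S) : Equiv.Perm (List X) :=
  Equiv.ofBijective (A.act s) (A.act_bijective h s)

/-- The (left) action of the free group on the states on the set of words over the alphabet. -/
noncomputable def freeAction (A : Mealy S X) (h : A.IsInvertible) :
    FreeGroup S →* Equiv.Perm (List X) :=
  FreeGroup.lift (A.statePerm h)

/-- The automaton group `G_A`: the quotient of the free group on the states by the kernel of its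
action on words. -/
abbrev AutomatonGroup (A : Mealy S X) (h : A.IsInvertible) : Type _ :=
  FreeGroup S ⧸ (A.freeAction h).ker

end Mealy

/-! ### VH square complexes with one vertex -/

/-- The letters `e` and `e⁻¹` for `e : E`, i.e. the two orientations of each loop: `(e, true)` is
the loop `e` in its own direction and `(e, false)` is the loop `e` traversed backwards. -/
abbrev Signed (E : Type*) := E × Bool

namespace Signed

/-- The oppositely oriented loop. -/
def inv {E : Type*} (e : Signed E) : Signed E := (e.1, !e.2)

/-- The oriented loop as an element of the free group. -/
def toFree {E : Type*} (e : Signed E) : FreeGroup E := FreeGroup.mk [e]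

end Signed

/-- A unit square with labelled sides. The vertical sides are read from bottom to top and the
horizontal sides from left to right. -/
@[ext] structure Tile (V H : Type*) where
  left : Signed V
  top : Signed H
  bottom : Signed H
  right : Signed V

namespace Tile

variable {V H : Type*}

/-- The square seen after exchanging top and bottom. -/
def flipV (c : Tile V H) : Tile V H := ⟨c.left.inv, c.bottom, c.top, c.right.inv⟩

/-- The square seen after exchanging left and right. -/
def flipH (c : Tile V H) : Tile V H := ⟨c.right, c.top.inv, c.bottom.inv, c.left⟩

end Tile

/-- A `VH` square complex with one vertex, given by combinatorial data: a set `V` of vertical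
loops, a set `H` of horizontal loops, and a set `Q` of squares, the square `q` being attached along
the closed path that is read along the boundary of `tile q`. -/
structure VHComplex (V H Q : Type*) where
  tile : Q → Tile V H

namespace VHComplex

variable {V H Q : Type*}

/-- The boundary path `left * top * right⁻¹ * bottom⁻¹` of a square, read clockwise from the bottom
left corner. It says that `left * top = bottom * right`. -/
def boundary (D : VHComplex V H Q) (q : Q) : FreeGroup (V ⊕ H) :=
  FreeGroup.map Sum.inl (D.tile q).left.toFree * FreeGroup.map Sum.inr (D.tile q).top.toFree *
    (FreeGroup.map Sum.inl (D.tile q).right.toFree)⁻¹ *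
    (FreeGroup.map Sum.inr (D.tile q).bottom.toFree)⁻¹

/-- The (edge-path) fundamental group of the complex. As there is only one vertex, closed edge paths
are words in the oriented loops, and they are taken modulo cancellation of `e * e⁻¹` and modulo the
boundary paths of the squares. -/
abbrev FundamentalGroup (D : VHComplex V H Q) : Type _ :=
  PresentedGroup (Set.range D.boundary)

/-- The square `p.1` seen from one of its four corners, which becomes the top left corner. -/
def view (D : VHComplex V H Q) (p : Q × Bool × Bool) : Tile V H :=
  let c := D.tile p.1
  let c := if p.2.1 then c.flipV else c
  if p.2.2 then c.flipH else c

/-- The complex is complete: the link of its vertex is a complete bipartite graph. The vertices of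
the link are the ends of the loops, and its edges are the corners of the squares; so completeness
says that for all oriented loops `s` (vertical) and `x` (horizontal) there is exactly one corner of
exactly one square with sides `s` and `x` there. -/
def IsComplete (D : VHComplex V H Q) : Prop :=
  ∀ (s : Signed V) (x : Signed H), ∃! p : Q × Bool × Bool,
    (D.view p).left = s ∧ (D.view p).top = x

/-- The automaton associated to a complete `VH` complex with one vertex. Its states are the oriented
vertical loops, its alphabet consists of the oriented horizontal loops, and there is an arrow
`s --x|y--> t` iff `s x = y t` is the relation read off a square, seen from one of its corners. -/
noncomputable def automaton (D : VHComplex V H Q) (h : D.IsComplete) :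
    Mealy (Signed V) (Signed H) where
  trans p := ((D.view (h p.1 p.2).choose).bottom, (D.view (h p.1 p.2).choose).right)

end VHComplex

/-! ### The complex `DeltaD` -/

/-- The vertical loops of `DeltaD`. -/
inductive VLoop
  | a
  | b
  deriving DecidableEq

/-- The horizontal loops of `DeltaD`. -/
inductive HLoop
  | x
  | y
  deriving DecidableEq

instance : Fintype VLoop := ⟨{.a, .b}, by rintro (_ | _) <;> simp⟩

instance : Fintype HLoop := ⟨{.x, .y}, by rintro (_ | _) <;> simp⟩

open VLoop HLoop in
/-- The complex with one vertex, loops `a`, `b` (vertical) and `x`, `y` (horizontal), and the four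
squares `a x = y b`, `a y = y⁻¹ b`, `b x = x a⁻¹`, `b y = x⁻¹ a`. -/
def DeltaD : VHComplex VLoop HLoop (Fin 4) where
  tile := ![⟨(a, true), (x, true), (y, true), (b, true)⟩,
            ⟨(a, true), (y, true), (y, false), (b, true)⟩,
            ⟨(b, true), (x, true), (x, true), (a, false)⟩,
            ⟨(b, true), (y, true), (x, false), (a, true)⟩]

theorem DeltaD_isComplete : DeltaD.IsComplete := by
  unfold VHComplex.IsComplete ExistsUnique
  decide

/-- The automaton associated to `DeltaD`. -/
noncomputable def automatonD : Mealy (Signed VLoop) (Signed HLoop) :=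
  DeltaD.automaton DeltaD_isComplete

/-! ### Words of states -/

/-! A relation `s z = w t` lets vertical letters act on horizontal words (through `mealyD`) and
horizontal letters on vertical words (through its dual). If a word of states acts trivially, so does
every word in its orbit under the dual (`ActsTrivially.dual_run`), so faithfulness follows once
these orbits are large. Large orbits come from one odometer criterion, `exists_iterate_run_eq`: when
every state adds a constant of `ZMod p` to its letter, a word of states is transitive on all levels
as soon as its additions have nonzero sum over each level.

For `G_A`: cubes of states act trivially, so every element of `C₃ * C₃` is given by a word
alternating between `a^±` and `b^±`. Horizontal letters act on the signs of alternating words by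
translations of `ZMod 2`, and `x⁻¹` followed by `y` is an odometer. A nonempty alternating word
acting trivially could thus have its last sign flipped and still act trivially, making a letter and
its inverse act alike, which is false. For the dual, reduced horizontal words are coded by `ZMod 3`
(three letters may follow a given one), and the pair `a`, `b` is an odometer on the reduced words
starting with `y`; hence no nonempty reduced word acts trivially and the group is free.

For residual finiteness: a cube of a vertical letter passes through a horizontal element unchanged
up to the choice of the letter, so finitely many cosets of a centralizer cover the horizontal
subgroup `H`. The vertical letters commensurate `H`. In a residually finite group these facts would
pass to profinite closures and force a finite-index subgroup of `H` to centralize all conjugates of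
`a³` (`exists_normal_commute_conj`). Some power of the odometer would then fix the reduced word `u
a³ u⁻¹`, hence its prefix `u`, for every alternating `u` of even length, contradicting transitivity.
-/

namespace Mealy

variable {S X : Type*}

/-- The transformation of words defined by a word of states, the head of which acts first. -/
def run (A : Mealy S X) (u : List S) (w : List X) : List X := u.foldl (fun v s => A.act s v) w

/-- The first letter of the output of a word of states. -/
def firstOutput (A : Mealy S X) (u : List S) (x : X) : X :=
  u.foldl (fun v s => (A.trans (s, v)).1) x

@[simp] theorem run_nil (A : Mealy S X) (w : List X) : A.run [] w = w := rfl

@[simp] theorem run_cons (A : Mealy S X) (s : S) (u : List S) (w : List X) :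
    A.run (s :: u) w = A.run u (A.act s w) := rfl

theorem run_append (A : Mealy S X) (u v : List S) (w : List X) :
    A.run (u ++ v) w = A.run v (A.run u w) := by
  simp [run]

theorem run_cons_word (A : Mealy S X) (u : List S) (x : X) (w : List X) :
    A.run u (x :: w) = A.firstOutput u x :: A.run (A.dual.act x u) w := by
  induction u generalizing x w with
  | nil => rfl
  | cons s u ih =>
    simp only [run_cons, act]
    rw [ih]
    rfl

@[simp] theorem length_act (A : Mealy S X) (s : S) (w : List X) :
    (A.act s w).length = w.length := by
  induction w generalizing s with
  | nil => rfl
  | cons x w ih => simp [act, ih]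

@[simp] theorem length_run (A : Mealy S X) (u : List S) (w : List X) :
    (A.run u w).length = w.length := by
  induction u generalizing w with
  | nil => rfl
  | cons s u ih => simp [ih]

theorem act_take (A : Mealy S X) (s : S) (n : ℕ) (w : List X) :
    A.act s (w.take n) = (A.act s w).take n := by
  induction w generalizing s n with
  | nil => simp [act]
  | cons x w ih =>
    cases n with
    | zero => simp [act]
    | succ n => simp [act, ih]

theorem run_take (A : Mealy S X) (u : List S) (n : ℕ) (w : List X) :
    A.run u (w.take n) = (A.run u w).take n := by
  induction u generalizing w with
  | nil => rfl
  | cons s u ih => rw [run_cons, run_cons, act_take, ih]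

theorem run_surjective (A : Mealy S X) (h : A.IsInvertible) (u : List S) :
    Function.Surjective (A.run u) := by
  induction u with
  | nil => exact fun w => ⟨w, rfl⟩
  | cons s u ih =>
    intro w
    obtain ⟨v, rfl⟩ := ih w
    obtain ⟨v, rfl⟩ := (A.act_bijective h s).2 v
    exact ⟨v, rfl⟩

theorem iterate_run (A : Mealy S X) (u : List S) (k : ℕ) :
    (A.run u)^[k] = A.run (List.replicate k u).flatten := by
  induction k with
  | zero => rfl
  | succ k ih =>
    funext w
    rw [Function.iterate_succ_apply, ih, List.replicate_succ, List.flatten_cons, run_append]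

/-- The word of states `u` acts trivially on all words. -/
def ActsTrivially (A : Mealy S X) (u : List S) : Prop := ∀ w, A.run u w = w

/-- The action on `x :: w` continues on `w` through the word of states `A.dual.act x u`, which must
therefore act trivially too. -/
theorem ActsTrivially.dual_run {A : Mealy S X} {u : List S} (h : A.ActsTrivially u)
    (v : List X) : A.ActsTrivially (A.dual.run v u) := by
  induction v generalizing u with
  | nil => exact h
  | cons x v ih =>
    refine ih fun w => ?_
    have := h (x :: w)
    rw [run_cons_word, List.cons.injEq] at this
    exact this.2

/-- Both letters undo the same surjective map `A.run u`, so they agree everywhere. -/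
theorem ActsTrivially.act_eq {A : Mealy S X} (hA : A.IsInvertible) {u : List S} {s t : S}
    (hs : A.ActsTrivially (u ++ [s])) (ht : A.ActsTrivially (u ++ [t])) : A.act s = A.act t := by
  funext w
  obtain ⟨v, rfl⟩ := A.run_surjective hA u w
  have h1 := hs v
  have h2 := ht v
  rw [run_append] at h1 h2
  exact h1.trans h2.symm

end Mealy

/-! ### Automata acting by translations of the letters -/

/-- The automaton over the alphabet `ZMod p` that in state `q` adds `r q` to the letter. -/
def Mealy.translation {Q : Type*} {p : ℕ} (r : Q → ZMod p) (next : Q → ZMod p → Q) :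
    Mealy Q (ZMod p) where
  trans c := (c.2 + r c.1, next c.1 c.2)

/-- The words of length `n` over `ZMod p`. -/
def ZMod.words (p : ℕ) [NeZero p] : ℕ → Finset (List (ZMod p))
  | 0 => {[]}
  | n + 1 => Finset.univ.biUnion fun i => (ZMod.words p n).image (List.cons i)

namespace Mealy

variable {Q : Type*} {p : ℕ}

theorem mem_words [NeZero p] {n : ℕ} {w : List (ZMod p)} : w ∈ ZMod.words p n ↔ w.length = n := by
  induction n generalizing w with
  | zero => simp [ZMod.words]
  | succ n ih =>
    cases w with
    | nil => simp [ZMod.words]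
    | cons i w => simp [ZMod.words, ih]

theorem sum_words_succ [NeZero p] (n : ℕ) (f : List (ZMod p) → ZMod p) :
    ∑ w ∈ ZMod.words p (n + 1), f w = ∑ i, ∑ w ∈ ZMod.words p n, f (i :: w) := by
  rw [ZMod.words, Finset.sum_biUnion]
  · refine Finset.sum_congr rfl fun i _ => ?_
    rw [Finset.sum_image]
    exact fun _ _ _ _ h => (List.cons.inj h).2
  · intro i _ j _ hij
    rw [Function.onFun, Finset.disjoint_left]
    intro w hw hw'
    obtain ⟨u, -, rfl⟩ := Finset.mem_image.1 hw
    obtain ⟨v, -, hv⟩ := Finset.mem_image.1 hw'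
    exact hij (List.cons.inj hv).1.symm

theorem translation_isInvertible (r : Q → ZMod p) (next : Q → ZMod p → Q) :
    (translation r next).IsInvertible := by
  intro q j
  refine ⟨(j - r q, next q (j - r q)), by simp [Arrow, translation], ?_⟩
  rintro ⟨i, t⟩ h
  simp only [Arrow, translation, Prod.mk.injEq] at h
  obtain ⟨rfl, rfl⟩ := h
  simp

variable (r : Q → ZMod p) (next : Q → ZMod p → Q)

/-- The amount added to the letter that follows `w`. -/
def shift : Q → List (ZMod p) → ZMod p
  | q, [] => r q
  | q, i :: w => shift (next q i) w

/-- The amount that a word of states adds to the letter that follows `w`. -/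
def totalShift : List Q → List (ZMod p) → ZMod p
  | [], _ => 0
  | q :: u, w => shift r next q w + totalShift u ((translation r next).act q w)

theorem translation_act_append (q : Q) (w : List (ZMod p)) (i : ZMod p) :
    (translation r next).act q (w ++ [i]) =
      (translation r next).act q w ++ [i + shift r next q w] := by
  induction w generalizing q with
  | nil => rfl
  | cons j w ih =>
    rw [List.cons_append, act, ih]
    rfl

theorem translation_run_append (u : List Q) (w : List (ZMod p)) (i : ZMod p) :
    (translation r next).run u (w ++ [i]) =
      (translation r next).run u w ++ [i + totalShift r next u w] := by
  induction u generalizing w i with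
  | nil => simp [totalShift]
  | cons q u ih =>
    rw [run_cons, translation_act_append, ih, run_cons, totalShift, add_assoc]

/-- The sum of the amounts added to the letters at level `n`. -/
def levelSum [NeZero p] : ℕ → Q → ZMod p
  | 0, q => r q
  | n + 1, q => ∑ i, levelSum n (next q i)

theorem sum_shift [NeZero p] (n : ℕ) (q : Q) :
    ∑ w ∈ ZMod.words p n, shift r next q w = levelSum r next n q := by
  induction n generalizing q with
  | zero => simp [ZMod.words, shift, levelSum]
  | succ n ih =>
    rw [sum_words_succ, levelSum]
    exact Finset.sum_congr rfl fun i _ => ih (next q i)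

/-- Each state permutes the words of length `n`, so the contribution of the later states may be
reindexed and the sum is additive in the word of states. -/
theorem sum_totalShift [NeZero p] (n : ℕ) (u : List Q) :
    ∑ w ∈ ZMod.words p n, totalShift r next u w = (u.map (levelSum r next n)).sum := by
  induction u with
  | nil => simp [totalShift]
  | cons q u ih =>
    simp only [totalShift, Finset.sum_add_distrib, sum_shift, List.map_cons, List.sum_cons, ← ih]
    congr 1
    have hb := (translation r next).act_bijective (translation_isInvertible r next) q
    refine Finset.sum_bij (fun w _ => (translation r next).act q w) ?_ ?_ ?_ ?_
    · intro w hw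
      rw [mem_words] at hw ⊢
      simpa using hw
    · exact fun _ _ _ _ h => hb.1 h
    · intro w hw
      obtain ⟨v, rfl⟩ := hb.2 w
      refine ⟨v, ?_, rfl⟩
      rw [mem_words] at hw ⊢
      simpa using hw
    · exact fun _ _ => rfl

theorem iterate_translation_run_append (u : List Q) (w : List (ZMod p)) (i : ZMod p) (k : ℕ) :
    ((translation r next).run u)^[k] (w ++ [i]) =
      ((translation r next).run u)^[k] w ++
        [i + ∑ j ∈ Finset.range k, totalShift r next u (((translation r next).run u)^[j] w)] := by
  induction k with
  | zero => simp
  | succ k ih =>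
    rw [Function.iterate_succ_apply', ih, translation_run_append, Function.iterate_succ_apply',
      Finset.sum_range_succ, add_assoc]

/-- A word of states whose level sums do not vanish acts as an odometer. -/
theorem exists_iterate_run_eq [Fact p.Prime] (u : List Q)
    (h : ∀ n, (u.map (levelSum r next n)).sum ≠ 0) (n : ℕ) (v w : List (ZMod p))
    (hv : v.length = n) (hw : w.length = n) :
    ∃ k, ((translation r next).run u)^[k] v = w := by
  induction n generalizing v w with
  | zero =>
    rw [List.length_eq_zero_iff] at hv hw
    exact ⟨0, by simp [hv, hw]⟩
  | succ n ih =>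
    set g := (translation r next).run u with hg
    have hlen : ∀ k w, (g^[k] w).length = w.length := by
      intro k w
      induction k with
      | zero => rfl
      | succ k ihk => rw [Function.iterate_succ_apply', hg, length_run, ← hg, ihk]
    obtain ⟨v, i, rfl⟩ : ∃ v' i, v = v' ++ [i] :=
      ⟨_, _, (List.dropLast_append_getLast (List.ne_nil_of_length_eq_add_one hv)).symm⟩
    obtain ⟨w, j, rfl⟩ : ∃ w' j, w = w' ++ [j] :=
      ⟨_, _, (List.dropLast_append_getLast (List.ne_nil_of_length_eq_add_one hw)).symm⟩
    simp only [List.length_append, List.length_singleton, Nat.add_right_cancel_iff] at hv hw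
    obtain ⟨k₀, hk₀⟩ := ih v w hv hw
    -- Transitivity on level `n` brings `g w` back to `w`.
    have hper : w ∈ Function.periodicPts g := by
      obtain ⟨k, hk⟩ := ih (g w) w ((hlen 1 w).trans hw) hw
      exact ⟨k + 1, Nat.succ_pos k, hk⟩
    set m := Function.minimalPeriod g w with hm
    have hmw : g^[m] w = w := Function.iterate_minimalPeriod
    have hm0 : 0 < m := Function.minimalPeriod_pos_of_mem_periodicPts hper
    -- The first return to `w` adds `c` to the next letter. The orbit of `w` is the whole level, so
    -- `c` is the level sum and is nonzero.
    set c := ∑ j ∈ Finset.range m, totalShift r next u (g^[j] w) with hc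
    have hc0 : c ≠ 0 := by
      have : c = ∑ w ∈ ZMod.words p n, totalShift r next u w := by
        refine Finset.sum_bij (fun k _ => g^[k] w) ?_ ?_ ?_ ?_
        · intro k _
          rw [mem_words, hlen, hw]
        · intro a ha b hb hab
          exact Function.iterate_injOn_Iio_minimalPeriod (by simpa using ha) (by simpa using hb) hab
        · intro v' hv'
          obtain ⟨k, hk⟩ := ih w v' hw (mem_words.1 hv')
          refine ⟨k % m, Finset.mem_range.2 (Nat.mod_lt _ hm0), ?_⟩
          rw [← hk, hm, Function.iterate_mod_minimalPeriod_eq]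
        · exact fun _ _ => rfl
      rw [this, sum_totalShift]
      exact h n
    have hstep : ∀ i, g^[m] (w ++ [i]) = w ++ [i + c] := by
      intro i
      rw [hg, iterate_translation_run_append, ← hg, hmw]
    have hsteps : ∀ l i, (g^[m])^[l] (w ++ [i]) = w ++ [i + l * c] := by
      intro l i
      induction l with
      | zero => simp
      | succ l ihl =>
        rw [Function.iterate_succ_apply', ihl, hstep]
        push_cast
        ring_nf
    set i' := i + ∑ j ∈ Finset.range k₀, totalShift r next u (g^[j] v) with hi'
    -- First `k₀` steps move the prefix to `w`; then `(j - i') / c` full returns correct the last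
    -- letter. Division by `c` is where `p` must be prime.
    refine ⟨m * ((j - i') * c⁻¹).val + k₀, ?_⟩
    rw [Function.iterate_add_apply, hg, iterate_translation_run_append, ← hg, hk₀, ← hi',
      Function.iterate_mul, hsteps, ZMod.natCast_zmod_val, inv_mul_cancel_right₀ hc0,
      add_sub_cancel]

end Mealy

/-! ### The automaton of `DeltaD` -/

open VLoop HLoop in
/-- The transition function of `automatonD`. -/
def stepD : Signed VLoop → Signed HLoop → Signed HLoop × Signed VLoop
  | (a, true), (x, true) => ((y, true), (b, true))
  | (a, true), (y, true) => ((y, false), (b, true))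
  | (a, true), (x, false) => ((x, false), (b, false))
  | (a, true), (y, false) => ((x, true), (b, true))
  | (b, true), (x, true) => ((x, true), (a, false))
  | (b, true), (y, true) => ((x, false), (a, true))
  | (b, true), (x, false) => ((y, false), (a, true))
  | (b, true), (y, false) => ((y, true), (a, true))
  | (a, false), (x, true) => ((y, false), (b, false))
  | (a, false), (y, true) => ((x, true), (b, false))
  | (a, false), (x, false) => ((x, false), (b, true))
  | (a, false), (y, false) => ((y, true), (b, false))
  | (b, false), (x, true) => ((x, true), (a, true))
  | (b, false), (y, true) => ((y, false), (a, false))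
  | (b, false), (x, false) => ((y, true), (a, false))
  | (b, false), (y, false) => ((x, false), (a, false))

theorem stepD_view (p : Fin 4 × Bool × Bool) :
    stepD (DeltaD.view p).left (DeltaD.view p).top =
      ((DeltaD.view p).bottom, (DeltaD.view p).right) := by
  revert p
  decide

/-- `automatonD` with an explicit transition function. -/
def mealyD : Mealy (Signed VLoop) (Signed HLoop) where
  trans c := stepD c.1 c.2

theorem automatonD_eq : automatonD = mealyD := by
  have h : automatonD.trans = mealyD.trans := by
    funext ⟨s, z⟩
    obtain ⟨h1, h2⟩ := (DeltaD_isComplete s z).choose_spec.1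
    have h3 := stepD_view (DeltaD_isComplete s z).choose
    rw [h1, h2] at h3
    exact h3.symm
  exact congrArg Mealy.mk h

theorem mealyD_isBireversible : mealyD.IsBireversible := by
  unfold Mealy.IsBireversible Mealy.Arrow ExistsUnique
  dsimp only
  refine ⟨?_, ?_, ?_⟩ <;> decide +kernel

/-! ### Alternating words in the vertical loops -/

namespace AlternatingWords

/-- The other vertical loop. -/
def other : VLoop → VLoop
  | .a => .b
  | .b => .a

/-- The sign encoded by an element of `ZMod 2`. -/
def sign (i : ZMod 2) : Bool := decide (i = 0)

/-- The alternating word that starts with the loop `v` and has prescribed signs. -/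
def word : VLoop → List (ZMod 2) → List (Signed VLoop)
  | _, [] => []
  | v, i :: w => (v, sign i) :: word (other v) w

/-- The change of sign of the letter `v` when it is read in the state `z`. -/
def change (c : Signed HLoop × VLoop) : ZMod 2 :=
  if (stepD (c.2, true) c.1).2.2 then 0 else 1

/-- The state after a letter has been read. -/
def next (c : Signed HLoop × VLoop) (i : ZMod 2) : Signed HLoop × VLoop :=
  ((stepD (c.2, sign i) c.1).1, other c.2)

/-- Every transition exchanges the loops `a` and `b`, so alternation survives. The two orientations
of a loop meet the same state with opposite output signs, so the sign is translated. -/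
theorem stepD_sign (v : VLoop) (i : ZMod 2) (z : Signed HLoop) :
    stepD (v, sign i) z = ((next (z, v) i).1, (other v, sign (i + change (z, v)))) := by
  revert v i z
  decide

theorem dual_act_word (z : Signed HLoop) (v : VLoop) (w : List (ZMod 2)) :
    mealyD.dual.act z (word v w) =
      word (other v) ((Mealy.translation change next).act (z, v) w) := by
  induction w generalizing z v with
  | nil => rfl
  | cons i w ih =>
    have h := stepD_sign v i z
    simp only [word, Mealy.act, Mealy.dual, mealyD, Mealy.translation, h]
    congr 1
    exact ih (next (z, v) i).1 (other v)

/-- A word of horizontal loops that maps alternating words starting with `a` to such words. -/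
def odometer : List (Signed HLoop) := [(.x, false), (.y, true)]

/-- The action of `odometer` on the signs. -/
def signOdometer : List (Signed HLoop × VLoop) := [((.x, false), .a), ((.y, true), .b)]

theorem dual_run_odometer (w : List (ZMod 2)) :
    mealyD.dual.run odometer (word .a w) =
      word .a ((Mealy.translation change next).run signOdometer w) := by
  simp only [odometer, signOdometer, Mealy.run_cons, Mealy.run_nil, dual_act_word, other]

theorem dual_iterate_odometer (k : ℕ) (w : List (ZMod 2)) :
    (mealyD.dual.run odometer)^[k] (word .a w) =
      word .a (((Mealy.translation change next).run signOdometer)^[k] w) := by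
  induction k generalizing w with
  | zero => rfl
  | succ k ih => rw [Function.iterate_succ_apply, dual_run_odometer, ih,
      Function.iterate_succ_apply]

/-- Each level sum arises from the previous one by a fixed linear operator on functions of the
finitely many states, so one coincidence between levels propagates. -/
theorem levelSum_add_two (n : ℕ) :
    Mealy.levelSum change next (n + 2) = Mealy.levelSum change next (n + 1) := by
  induction n with
  | zero =>
    funext c
    revert c
    decide +kernel
  | succ n ih =>
    funext c
    exact Finset.sum_congr rfl fun i _ => congrFun ih (next c i)

theorem levelSum_signOdometer (n : ℕ) :
    (signOdometer.map (Mealy.levelSum change next n)).sum ≠ 0 := by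
  match n with
  | 0 => decide +kernel
  | n + 1 =>
    have h : Mealy.levelSum change next (n + 1) = Mealy.levelSum change next 1 := by
      induction n with
      | zero => rfl
      | succ n ih => rw [levelSum_add_two, ih]
    rw [h]
    decide +kernel

theorem exists_iterate_eq (v w : List (ZMod 2)) (h : v.length = w.length) :
    ∃ k, (mealyD.dual.run odometer)^[k] (word .a v) = word .a w := by
  obtain ⟨k, hk⟩ := Mealy.exists_iterate_run_eq change next signOdometer levelSum_signOdometer
    w.length v w h rfl
  exact ⟨k, by rw [dual_iterate_odometer, hk]⟩

theorem word_append (v : VLoop) (w w' : List (ZMod 2)) :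
    word v (w ++ w') = word v w ++ word (other^[w.length] v) w' := by
  induction w generalizing v with
  | nil => rfl
  | cons i w ih => simp [word, ih]

theorem word_injective (v : VLoop) : Function.Injective (word v) := by
  intro w w' h
  induction w generalizing v w' with
  | nil => cases w' <;> simp_all [word]
  | cons i w ih =>
    cases w' with
    | nil => simp [word] at h
    | cons j w' =>
      simp only [word, List.cons.injEq, Prod.mk.injEq, true_and] at h
      have hs : ∀ i j, sign i = sign j → i = j := by decide
      rw [ih _ h.2, hs i j h.1]

end AlternatingWords

theorem Mealy.ActsTrivially.dual_iterate {S X : Type*} {A : Mealy S X} {u : List S}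
    (h : A.ActsTrivially u) (v : List X) (k : ℕ) :
    A.ActsTrivially ((A.dual.run v)^[k] u) := by
  rw [Mealy.iterate_run]
  exact h.dual_run _

open AlternatingWords in
-- A power of the odometer changes only the last sign. Both words would act trivially, so the last
-- letter and its inverse would act alike; one-letter words refute this.
theorem not_actsTrivially_word_a (w : List (ZMod 2)) (hw : w ≠ []) :
    ¬ mealyD.ActsTrivially (word .a w) := by
  intro h
  obtain ⟨w, i, rfl⟩ : ∃ w' i, w = w' ++ [i] := ⟨_, _, (List.dropLast_append_getLast hw).symm⟩
  obtain ⟨k, hk⟩ := exists_iterate_eq (w ++ [i]) (w ++ [i + 1]) (by simp)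
  have h' := h.dual_iterate odometer k
  rw [hk] at h'
  simp only [word_append, word] at h h'
  have := h.act_eq mealyD_isBireversible.isInvertible h'
  have h2 : ∀ v i, ∃ z, mealyD.act (v, sign i) [z] ≠ mealyD.act (v, sign (i + 1)) [z] := by
    decide +kernel
  obtain ⟨z, hz⟩ := h2 (other^[w.length] .a) i
  exact hz (congrFun this [z])

open AlternatingWords in
/-- Nonempty alternating words act nontrivially. -/
theorem not_actsTrivially_word (v : VLoop) (w : List (ZMod 2)) (hw : w ≠ []) :
    ¬ mealyD.ActsTrivially (word v w) := by
  cases v with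
  | a => exact not_actsTrivially_word_a w hw
  | b =>
    intro h
    -- One horizontal letter turns an alternating word starting with `b` into one of the same length
    -- starting with `a`.
    have h' := h.dual_run [(.x, true)]
    rw [Mealy.run_cons, Mealy.run_nil, dual_act_word] at h'
    refine not_actsTrivially_word_a _ ?_ h'
    rw [← List.length_pos_iff] at hw ⊢
    simpa using hw

/-! ### Reduced words in the horizontal loops -/

namespace ReducedWords

open HLoop in
/-- The three oriented horizontal loops different from `p`, in a cyclic order that is compatible
with the action of the states. -/
def letter : Signed HLoop → Fin 3 → Signed HLoop
  | (x, false) => ![(x, true), (y, true), (y, false)]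
  | (y, false) => ![(x, true), (x, false), (y, true)]
  | (y, true) => ![(x, true), (y, false), (x, false)]
  | (x, true) => ![(y, true), (x, false), (y, false)]

/-- The position of a letter in the order given by `letter`. -/
def index (p z : Signed HLoop) : ZMod 3 :=
  if letter p 0 = z then 0 else if letter p 1 = z then 1 else 2

/-- The reduced words that do not start with `p`. -/
def word : Signed HLoop → List (ZMod 3) → List (Signed HLoop)
  | _, [] => []
  | p, i :: w => letter p i :: word (letter p i).inv w

/-- The rotation defined by the state `s` on the letters different from `p`. -/
def rotation (c : Signed VLoop × Signed HLoop) : ZMod 3 :=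
  index (stepD c.1 c.2).1 (stepD c.1 (letter c.2 0)).1

/-- The state after a letter has been read. -/
def next (c : Signed VLoop × Signed HLoop) (i : ZMod 3) : Signed VLoop × Signed HLoop :=
  ((stepD c.1 (letter c.2 i)).2, (letter c.2 i).inv)

/-- The cyclic orders are chosen so that each state acts on the three permitted letters by a
rotation. The second equation tracks the letter forbidden next: the inverse of the letter just read
goes to the inverse of the letter just written. -/
theorem stepD_letter : ∀ (s : Signed VLoop) (p : Signed HLoop) (i : ZMod 3),
    stepD s (letter p i) = (letter (stepD s p).1 (i + rotation (s, p)), (next (s, p) i).1) ∧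
    (stepD (next (s, p) i).1 (next (s, p) i).2).1 =
      (letter (stepD s p).1 (i + rotation (s, p))).inv := by
  decide +kernel

theorem act_word (s : Signed VLoop) (p : Signed HLoop) (w : List (ZMod 3)) :
    mealyD.act s (word p w) =
      word (stepD s p).1 ((Mealy.translation rotation next).act (s, p) w) := by
  induction w generalizing s p with
  | nil => rfl
  | cons i w ih =>
    obtain ⟨h, h'⟩ := stepD_letter s p i
    simp only [word, Mealy.act, mealyD, Mealy.translation, h]
    congr 1
    have := ih (next (s, p) i).1 (next (s, p) i).2
    rw [h'] at this
    exact this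

open VLoop in
theorem run_word (w : List (ZMod 3)) :
    mealyD.run [(b, true), (a, true)] (word (.y, false) w) =
      word (.y, false) ((Mealy.translation rotation next).run
        [((b, true), (.y, false)), ((a, true), (.y, true))] w) := by
  simp only [Mealy.run_cons, Mealy.run_nil, act_word]
  rfl

open VLoop in
-- The pair `a`, `b` fixes the letter `y` and continues as `b`, `a`, which preserves the forbidden
-- letter `y⁻¹`.
theorem run_cons_word (w : List (ZMod 3)) :
    mealyD.run [(a, true), (b, true)] ((.y, true) :: word (.y, false) w) =
      (.y, true) :: word (.y, false) ((Mealy.translation rotation next).run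
        [((b, true), (.y, false)), ((a, true), (.y, true))] w) := by
  rw [← run_word, Mealy.run_cons_word]
  rfl

open VLoop in
theorem iterate_run_cons_word (k : ℕ) (w : List (ZMod 3)) :
    (mealyD.run [(a, true), (b, true)])^[k] ((.y, true) :: word (.y, false) w) =
      (.y, true) :: word (.y, false) (((Mealy.translation rotation next).run
        [((b, true), (.y, false)), ((a, true), (.y, true))])^[k] w) := by
  induction k generalizing w with
  | zero => rfl
  | succ k ih => rw [Function.iterate_succ_apply, run_cons_word, ih, Function.iterate_succ_apply]

/-- From level one on, the iterated linear operator has period two on these level sums. -/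
theorem levelSum_add_three (n : ℕ) :
    Mealy.levelSum rotation next (n + 3) = Mealy.levelSum rotation next (n + 1) := by
  induction n with
  | zero =>
    funext c
    revert c
    decide +kernel
  | succ n ih =>
    funext c
    exact Finset.sum_congr rfl fun i _ => congrFun ih (next c i)

open VLoop in
theorem levelSum_ne_zero (n : ℕ) :
    ([((b, true), (.y, false)), ((a, true), (.y, true))].map
      (Mealy.levelSum rotation next n)).sum ≠ 0 := by
  induction n using Nat.strong_induction_on with
  | _ n ih =>
    match n, ih with
    | 0, _ => decide +kernel
    | 1, _ => decide +kernel
    | 2, _ => decide +kernel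
    | n + 3, ih =>
      rw [levelSum_add_three]
      exact ih (n + 1) (by omega)

theorem word_append (p : Signed HLoop) (w : List (ZMod 3)) :
    ∃ q, ∀ w', word p (w ++ w') = word p w ++ word q w' := by
  induction w generalizing p with
  | nil => exact ⟨p, fun _ => rfl⟩
  | cons i w ih =>
    obtain ⟨q, hq⟩ := ih (letter p i).inv
    exact ⟨q, fun w' => by simp [word, hq]⟩

end ReducedWords

open ReducedWords in
theorem not_actsTrivially_cons_word_y (w : List (ZMod 3)) :
    ¬ mealyD.dual.ActsTrivially ((.y, true) :: word (.y, false) w) := by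
  intro h
  rcases List.eq_nil_or_concat w with rfl | ⟨w, i, rfl⟩
  · have h1 : mealyD.dual.run [(.y, true)] [(.a, true)] ≠ [(.a, true)] := by decide +kernel
    exact h1 (h _)
  · rw [List.concat_eq_append] at h
    obtain ⟨k, hk⟩ := Mealy.exists_iterate_run_eq rotation next _ levelSum_ne_zero _
      (w ++ [i]) (w ++ [i + 1]) rfl (by simp)
    have h' := h.dual_iterate [(.a, true), (.b, true)] k
    change mealyD.dual.ActsTrivially
      ((mealyD.run [(.a, true), (.b, true)])^[k] _) at h'
    rw [iterate_run_cons_word, hk] at h'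
    obtain ⟨q, hq⟩ := word_append (.y, false) w
    rw [hq] at h h'
    have := Mealy.ActsTrivially.act_eq mealyD_isBireversible.dual_isInvertible
      (u := (.y, true) :: word (.y, false) w) h h'
    -- Two letters are needed: `y` and `y⁻¹` have the same output on every single letter.
    have h2 : ∀ q i, ∃ s t, mealyD.dual.act (letter q i) [s, t] ≠
        mealyD.dual.act (letter q (i + 1)) [s, t] := by
      decide +kernel
    obtain ⟨s, t, hst⟩ := h2 q i
    exact hst (congrFun this _)

open ReducedWords in
-- Two suitable vertical letters carry any first letter to `y`, and the forbidden letter to `y⁻¹`,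
-- which reduces to the case already treated.
theorem not_actsTrivially_cons_word (z : Signed HLoop) (w : List (ZMod 3)) :
    ¬ mealyD.dual.ActsTrivially (z :: word z.inv w) := by
  intro h
  have h1 : ∀ z, ∃ s t, mealyD.firstOutput [s, t] z = (.y, true) ∧
      (stepD (stepD s z).2 z.inv).1 = (stepD s z).1.inv ∧
      (stepD (stepD t (stepD s z).1).2 (stepD s z).1.inv).1 = (.y, false) := by
    decide +kernel
  obtain ⟨s, t, h2, h3, h4⟩ := h1 z
  have h' := h.dual_run [s, t]
  change mealyD.dual.ActsTrivially (mealyD.run [s, t] _) at h'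
  have h5 : mealyD.dual.act z [s, t] = [(stepD s z).2, (stepD t (stepD s z).1).2] := rfl
  rw [Mealy.run_cons_word, h2, h5, Mealy.run_cons, Mealy.run_cons, Mealy.run_nil, act_word,
    act_word, h3, h4] at h'
  exact not_actsTrivially_cons_word_y _ h'

open ReducedWords in
/-- Nonempty reduced words act nontrivially. -/
theorem not_actsTrivially_of_isReduced {u : List (Signed HLoop)} (hu : FreeGroup.IsReduced u)
    (hne : u ≠ []) : ¬ mealyD.dual.ActsTrivially u := by
  have key : ∀ (u : List (Signed HLoop)) (z : Signed HLoop), FreeGroup.IsReduced (z :: u) →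
      ∃ w, u = word z.inv w := by
    intro u
    induction u with
    | nil => exact fun _ _ => ⟨[], rfl⟩
    | cons t u ih =>
      intro z h
      rw [FreeGroup.isReduced_cons_cons] at h
      obtain ⟨w, hw⟩ := ih t h.2
      have h1 : ∀ z t : Signed HLoop, (z.1 = t.1 → z.2 = t.2) → ∃ i, letter z.inv i = t := by
        decide +kernel
      obtain ⟨i, hi⟩ := h1 z t h.1
      exact ⟨i :: w, by simp only [word, hi, ← hw]⟩
  cases u with
  | nil => exact absurd rfl hne
  | cons z u =>
    obtain ⟨w, rfl⟩ := key u z hu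
    exact not_actsTrivially_cons_word z w

/-! ### The automaton groups -/

namespace Mealy

variable {S X : Type*}

/-- If the action of the free group on the states factors through a surjection onto `P` followed by
a faithful action of `P`, then the automaton group is isomorphic to `P`. -/
theorem nonempty_automatonGroup_mulEquiv (A : Mealy S X) (h : A.IsInvertible) {P : Type*} [Group P]
    (f : FreeGroup S →* P) (hf : Function.Surjective f) (g : P →* Equiv.Perm (List X))
    (hg : Function.Injective g) (hgf : ∀ s, g (f (FreeGroup.of s)) = A.statePerm h s) :
    Nonempty (A.AutomatonGroup h ≃* P) := by
  have h1 : A.freeAction h = g.comp f := by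
    ext1 s
    simp [freeAction, hgf]
  have h2 : (A.freeAction h).ker = f.ker := by
    ext x
    rw [h1, MonoidHom.mem_ker, MonoidHom.mem_ker, MonoidHom.comp_apply, map_eq_one_iff g hg]
  exact ⟨(QuotientGroup.quotientMulEquivOfEq h2).trans
    (QuotientGroup.quotientKerEquivOfSurjective f hf)⟩

/-- Permutations compose from the right while `run` applies the head first, hence the reversal. -/
theorem prod_statePerm_apply (A : Mealy S X) (h : A.IsInvertible) (u : List S) (w : List X) :
    (u.reverse.map (A.statePerm h)).prod w = A.run u w := by
  induction u generalizing w with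
  | nil => rfl
  | cons s u ih =>
    rw [List.reverse_cons, List.map_append, List.prod_append, Equiv.Perm.mul_apply, ih]
    rfl

end Mealy

/-! ### Inverse states, states of order three, and the two isomorphisms -/

theorem mealyD_act_inv_act (s : Signed VLoop) (w : List (Signed HLoop)) :
    mealyD.act s.inv (mealyD.act s w) = w := by
  induction w generalizing s with
  | nil => rfl
  | cons z w ih =>
    have h : ∀ s z, (stepD (Signed.inv s) (stepD s z).1) = (z, (stepD s z).2.inv) := by decide
    simp only [Mealy.act, mealyD, h]
    congr 1
    exact ih _

theorem mealyD_dual_act_inv_act (z : Signed HLoop) (w : List (Signed VLoop)) :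
    mealyD.dual.act z.inv (mealyD.dual.act z w) = w := by
  induction w generalizing z with
  | nil => rfl
  | cons s w ih =>
    have h : ∀ s z, (stepD (stepD s z).2 (Signed.inv z)) = ((stepD s z).1.inv, s) := by decide
    simp only [Mealy.act, mealyD, Mealy.dual, h]
    congr 1
    exact ih _

/-- The triple `s, s, s` fixes every letter and continues as a triple `t, t, t`, so the induction
closes. -/
theorem mealyD_act_act_act (s : Signed VLoop) (w : List (Signed HLoop)) :
    mealyD.act s (mealyD.act s (mealyD.act s w)) = w := by
  change mealyD.run [s, s, s] w = w
  induction w generalizing s with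
  | nil => rfl
  | cons z w ih =>
    have h : ∀ s z, mealyD.firstOutput [s, s, s] z = z ∧
        ∃ t, mealyD.dual.act z [s, s, s] = [t, t, t] := by decide +kernel
    obtain ⟨h1, t, h2⟩ := h s z
    rw [Mealy.run_cons_word, h1, h2, ih]

theorem Mealy.statePerm_inv {S X : Type*} (A : Mealy S X) (h : A.IsInvertible) (s t : S)
    (hst : ∀ w, A.act t (A.act s w) = w) : (A.statePerm h s)⁻¹ = A.statePerm h t := by
  rw [inv_eq_iff_mul_eq_one, mul_eq_one_iff_inv_eq, eq_comm, eq_inv_iff_mul_eq_one]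
  ext1 w
  exact hst w

/-- The automaton group of the dual automaton is free of rank two. -/
theorem nonempty_automatonGroup_dual_mulEquiv (h : mealyD.dual.IsInvertible) :
    Nonempty (mealyD.dual.AutomatonGroup h ≃* FreeGroup (Fin 2)) := by
  let e : HLoop ≃ Fin 2 :=
    { toFun := fun | .x => 0 | .y => 1
      invFun := ![.x, .y]
      left_inv := by rintro (_ | _) <;> rfl
      right_inv := by decide }
  let f : FreeGroup (Signed HLoop) →* FreeGroup HLoop := FreeGroup.lift Signed.toFree
  let g : FreeGroup HLoop →* Equiv.Perm (List (Signed VLoop)) :=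
    FreeGroup.lift fun z => mealyD.dual.statePerm h (z, true)
  have hg : ∀ z : Signed HLoop, g (FreeGroup.mk [z]) = mealyD.dual.statePerm h z := by
    rintro ⟨z, _ | _⟩
    · simp only [g, FreeGroup.lift_mk]
      simpa using Mealy.statePerm_inv _ h (z, true) (z, false) (mealyD_dual_act_inv_act (z, true))
    · simp [g, FreeGroup.lift_mk]
  have hgL : ∀ L : List (Signed HLoop), g (FreeGroup.mk L) =
      (L.map (mealyD.dual.statePerm h)).prod := by
    intro L
    induction L with
    | nil => exact map_one g
    | cons z L ih =>
      rw [← List.singleton_append, ← FreeGroup.mul_mk, map_mul, hg, ih]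
      simp
  refine (mealyD.dual.nonempty_automatonGroup_mulEquiv h f ?_ g ?_ ?_).map fun E =>
    E.trans (FreeGroup.freeGroupCongr e)
  · rw [← MonoidHom.range_eq_top, eq_top_iff, ← FreeGroup.closure_range_of, Subgroup.closure_le]
    rintro _ ⟨z, rfl⟩
    exact ⟨FreeGroup.of (z, true), by simp [f, Signed.toFree, FreeGroup.of]⟩
  · rw [injective_iff_map_eq_one]
    intro p hp
    by_contra hne
    refine not_actsTrivially_of_isReduced (u := p.toWord.reverse) ?_ ?_ ?_
    · have := FreeGroup.isReduced_toWord (x := p)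
      unfold FreeGroup.IsReduced at this ⊢
      rw [List.isChain_reverse]
      exact this.imp fun a b hab hba => (hab hba.symm).symm
    · simpa using hne
    · intro w
      rw [← Mealy.prod_statePerm_apply _ h, List.reverse_reverse, ← hgL, FreeGroup.mk_toWord, hp]
      rfl
  · intro z
    simp [f, Signed.toFree, hg]

/-- The homomorphism from the cyclic group of order `n` defined by an element whose order
divides `n`. -/
def cyclicLift {G : Type*} [Group G] {n : ℕ} [NeZero n] (g : G) (hg : g ^ n = 1) :
    Multiplicative (ZMod n) →* G :=
  MonoidHom.mk' (fun i => g ^ i.toAdd.val) fun i j => by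
    rw [toAdd_mul, ZMod.val_add, ← pow_add, ← pow_eq_pow_mod _ hg]

/-! ### Alternating normal forms in the free product -/

namespace AlternatingWords

/-- The generator of the free product of two cyclic groups of order three given by a vertical
loop. -/
def loopGen : VLoop → Monoid.Coprod (Multiplicative (ZMod 3)) (Multiplicative (ZMod 3))
  | .a => Monoid.Coprod.inl (Multiplicative.ofAdd 1)
  | .b => Monoid.Coprod.inr (Multiplicative.ofAdd 1)

/-- The element of the free product given by an oriented vertical loop. -/
def gen (s : Signed VLoop) : Monoid.Coprod (Multiplicative (ZMod 3)) (Multiplicative (ZMod 3)) :=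
  if s.2 then loopGen s.1 else (loopGen s.1)⁻¹

/-- The product of a word, read backwards. -/
def value (u : List (Signed VLoop)) :
    Monoid.Coprod (Multiplicative (ZMod 3)) (Multiplicative (ZMod 3)) :=
  (u.reverse.map gen).prod

theorem value_cons (s : Signed VLoop) (u : List (Signed VLoop)) :
    value (s :: u) = value u * gen s := by
  simp [value]

theorem loopGen_pow_three (v : VLoop) : loopGen v ^ 3 = 1 := by
  have h : (Multiplicative.ofAdd (1 : ZMod 3)) ^ 3 = 1 := by decide
  cases v
  · rw [loopGen, ← map_pow, h, map_one]
  · rw [loopGen, ← map_pow, h, map_one]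

/-- As `value` reads backwards, right multiplication acts on the head of the word. Either the loop
differs and is prepended, or it squares to its inverse, or it cancels. -/
theorem exists_value_mul_loopGen (v v' : VLoop) (w : List (ZMod 2)) :
    ∃ u w', value (word v' w) * loopGen v = value (word u w') := by
  cases w with
  | nil => exact ⟨v, [0], by simp [word, value, gen, sign]⟩
  | cons i w =>
    by_cases hv : v = v'
    · subst hv
      have hi : i = 0 ∨ i = 1 := by revert i; decide
      have h3 := loopGen_pow_three v
      rcases hi with rfl | rfl
      · refine ⟨v, 1 :: w, ?_⟩
        have : loopGen v * loopGen v = (loopGen v)⁻¹ := by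
          rw [eq_inv_iff_mul_eq_one, ← h3, pow_three']
        simp [word, value_cons, gen, sign, mul_assoc, this]
      · refine ⟨other v, w, ?_⟩
        simp [word, value_cons, gen, sign]
    · refine ⟨v, 0 :: i :: w, ?_⟩
      have : other v = v' := by revert v v'; decide
      have hw : word v (0 :: i :: w) = (v, true) :: word v' (i :: w) := by rw [← this]; rfl
      rw [hw, value_cons]
      rfl

theorem mul_pow_mem {M : Type*} [Monoid M] {T : Set M} {q : M} (h : ∀ p ∈ T, p * q ∈ T) (n : ℕ) :
    ∀ p ∈ T, p * q ^ n ∈ T := by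
  induction n with
  | zero => simp
  | succ n ih =>
    intro p hp
    rw [pow_succ, ← mul_assoc]
    exact h _ (ih p hp)

/-- Every element of the free product is the value of an alternating word. -/
theorem exists_eq_value
    (p : Monoid.Coprod (Multiplicative (ZMod 3)) (Multiplicative (ZMod 3))) :
    ∃ v w, p = value (word v w) := by
  let T : Set (Monoid.Coprod (Multiplicative (ZMod 3)) (Multiplicative (ZMod 3))) :=
    {p | ∃ v w, p = value (word v w)}
  have hgen : ∀ v, ∀ p ∈ T, p * loopGen v ∈ T := by
    rintro v _ ⟨v', w, rfl⟩
    obtain ⟨u, w', h⟩ := exists_value_mul_loopGen v v' w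
    exact ⟨u, w', h⟩
  have hpow : ∀ i : Multiplicative (ZMod 3), i = Multiplicative.ofAdd 1 ^ i.toAdd.val := by decide
  have key : ∀ q, ∀ p ∈ T, p * q ∈ T := by
    intro q
    induction q using Monoid.Coprod.induction_on with
    | inl i =>
      rw [hpow i, map_pow]
      exact mul_pow_mem (hgen .a) _
    | inr i =>
      rw [hpow i, map_pow]
      exact mul_pow_mem (hgen .b) _
    | mul q q' h h' =>
      intro p hp
      rw [← mul_assoc]
      exact h' _ (h p hp)
  have := key p 1 ⟨.a, [], by simp [word, value]⟩
  rwa [one_mul] at this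

end AlternatingWords

open AlternatingWords in
/-- The automaton group of `DeltaD` is the free product of two cyclic groups of order three. -/
theorem nonempty_automatonGroup_mulEquiv_coprod (h : mealyD.IsInvertible) :
    Nonempty (mealyD.AutomatonGroup h ≃*
      Monoid.Coprod (Multiplicative (ZMod 3)) (Multiplicative (ZMod 3))) := by
  have h3 : ∀ s, mealyD.statePerm h s ^ 3 = 1 := fun s =>
    Equiv.ext fun w => mealyD_act_act_act s w
  let g : Monoid.Coprod (Multiplicative (ZMod 3)) (Multiplicative (ZMod 3)) →*
      Equiv.Perm (List (Signed HLoop)) :=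
    Monoid.Coprod.lift (cyclicLift _ (h3 (.a, true))) (cyclicLift _ (h3 (.b, true)))
  have hloop : ∀ v, g (loopGen v) = mealyD.statePerm h (v, true) := by
    rintro (_ | _)
    · exact (Monoid.Coprod.lift_apply_inl _ _ _).trans (pow_one _)
    · exact (Monoid.Coprod.lift_apply_inr _ _ _).trans (pow_one _)
  have hg : ∀ s, g (gen s) = mealyD.statePerm h s := by
    rintro ⟨v, _ | _⟩
    · rw [gen, if_neg (by simp), map_inv, hloop]
      exact Mealy.statePerm_inv _ h (v, true) (v, false) (mealyD_act_inv_act (v, true))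
    · rw [gen, if_pos rfl, hloop]
  refine mealyD.nonempty_automatonGroup_mulEquiv h (FreeGroup.lift gen) ?_ g ?_ ?_
  · intro p
    obtain ⟨v, w, rfl⟩ := exists_eq_value p
    refine ⟨((word v w).reverse.map FreeGroup.of).prod, ?_⟩
    rw [map_list_prod, List.map_map, value]
    congr 2
    funext s
    simp
  · rw [injective_iff_map_eq_one]
    intro p hp
    obtain ⟨v, w, rfl⟩ := exists_eq_value p
    by_cases hw : w = []
    · subst hw
      simp [word, value]
    · refine absurd (fun u => ?_) (not_actsTrivially_word v w hw)
      rw [← Mealy.prod_statePerm_apply _ h]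
      have : (List.map (mealyD.statePerm h) (word v w).reverse).prod = g (value (word v w)) := by
        rw [value, map_list_prod, List.map_map]
        congr 2
        funext s
        exact (hg s).symm
      rw [this, hp]
      rfl
  · intro s
    simp [hg]

/-! ### The profinite topology -/

section ProfiniteTopology

variable {G : Type*} [Group G]

/-- The closure of a subgroup in the profinite topology. -/
def profiniteClosure (K : Subgroup G) : Set G :=
  {g | ∀ M : Subgroup G, M.Normal → M.FiniteIndex → g ∈ K ⊔ M}

/-- If `K` is covered by finitely many cosets of `D`, then the closure of `D` is a neighbourhood of
the identity in the closure of `K`. -/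
theorem exists_mem_profiniteClosure {K D : Subgroup G} {ι : Type*} [Finite ι] (R : G → ι → Prop)
    (hR : ∀ k ∈ K, ∃ i, R k i)
    (hD : ∀ k ∈ K, ∀ k' ∈ K, ∀ i, R k i → R k' i → k * k'⁻¹ ∈ D) :
    ∃ M : Subgroup G, M.Normal ∧ M.FiniteIndex ∧
      ∀ g ∈ profiniteClosure K, g ∈ M → g ∈ profiniteClosure D := by
  -- For each class with an element outside the closure of `D`, fix one such element and a subgroup
  -- `M` separating it from `D`.
  have h1 : ∀ i, ∃ M : Subgroup G, M.Normal ∧ M.FiniteIndex ∧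
      ((∃ k ∈ K, R k i ∧ k ∉ profiniteClosure D) → ∃ k ∈ K, R k i ∧ k ∉ D ⊔ M) := by
    intro i
    by_cases h : ∃ k ∈ K, R k i ∧ k ∉ profiniteClosure D
    · obtain ⟨k, hk, hki, hkD⟩ := h
      simp only [profiniteClosure, Set.mem_ofPred_eq, not_forall] at hkD
      obtain ⟨M, hM, hM', hkM⟩ := hkD
      exact ⟨M, hM, hM', fun _ => ⟨k, hk, hki, hkM⟩⟩
    · exact ⟨⊤, inferInstance, inferInstance, fun h' => absurd h' h⟩
  choose M hM hM' h using h1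
  have hn : (⨅ i, M i).Normal := Subgroup.normal_iInf_normal hM
  have hf : (⨅ i, M i).FiniteIndex := Subgroup.finiteIndex_iInf hM'
  refine ⟨⨅ i, M i, hn, hf, fun g hg hgM N hN hN' => ?_⟩
  have hg' := hg (N ⊓ ⨅ i, M i) inferInstance inferInstance
  rw [Subgroup.mem_sup_of_normal_right] at hg'
  obtain ⟨k, hk, m, hm, rfl⟩ := hg'
  have hkM : k ∈ ⨅ i, M i := ((⨅ i, M i).mul_mem_cancel_right hm.2).1 hgM
  have hkD : k ∈ profiniteClosure D := by
    by_contra hkD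
    obtain ⟨i, hi⟩ := hR k hk
    obtain ⟨k', hk', hi', hkD'⟩ := h i ⟨k, hk, hi, hkD⟩
    -- The elements `k` and `k'` of one class differ by an element of `D`, and `k` lies in `M i`, so
    -- `k'` would lie in `D ⊔ M i`.
    apply hkD'
    have h2 := hD k hk k' hk' i hi hi'
    have h3 : k ∈ M i := Subgroup.mem_iInf.1 hkM i
    have h4 : k' = (k * k'⁻¹)⁻¹ * k := by group
    rw [h4]
    exact mul_mem (inv_mem (Subgroup.mem_sup_left h2)) (Subgroup.mem_sup_right h3)
  exact mul_mem (hkD N hN hN') (Subgroup.mem_sup_right hm.1)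

/-- Centralizers are closed: modulo any normal subgroup of finite index `g` agrees with an element
centralizing `c`, so the commutator of `g` and `c` lies in all such subgroups. -/
theorem profiniteClosure_centralizer [Group.ResiduallyFinite G] {c g : G}
    (hg : g ∈ profiniteClosure (Subgroup.centralizer {c})) : g * c = c * g := by
  rw [← mul_inv_eq_one]
  refine Group.residuallyFinite_iff_forall_finiteIndexNormalSubgroup.1 inferInstance _ fun H => ?_
  have hn : H.toSubgroup.Normal := H.isNormal'
  have hg' := hg H.toSubgroup hn H.isFiniteIndex'
  rw [Subgroup.mem_sup_of_normal_right] at hg'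
  obtain ⟨z, hz, m, hm, rfl⟩ := hg'
  rw [Subgroup.mem_centralizer_singleton_iff] at hz
  have h1 : z * m * c * (c * (z * m))⁻¹ = z * (m * (c * m⁻¹ * c⁻¹)) * z⁻¹ := by
    have : (c * (z * m))⁻¹ = m⁻¹ * c⁻¹ * z⁻¹ := by rw [← mul_assoc, ← hz]; group
    rw [this]
    group
  rw [h1]
  exact hn.conj_mem _ (mul_mem hm (hn.conj_mem _ (inv_mem hm) c)) z

/-- In a residually finite group, let `A` be a subgroup that is commensurated by a finite set of
generators, and such that the centralizer of `c` contains a subgroup of finite index of `A`. Then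
a subgroup of finite index of `A` centralizes all conjugates of `c`. -/
theorem exists_normal_commute_conj [Group.ResiduallyFinite G] {ι F : Type*} [Finite ι] [Finite F]
    (A : Subgroup G) (c : G) (t : ι → G) (ht : Subgroup.closure (Set.range t) = ⊤)
    (hinv : ∀ i, ∃ j, t j = (t i)⁻¹) (R : ι → G → F → Prop) (hR : ∀ i, ∀ k ∈ A, ∃ f, R i k f)
    (hA : ∀ i, ∀ k ∈ A, ∀ k' ∈ A, ∀ f, R i k f → R i k' f → (t i)⁻¹ * (k * k'⁻¹) * t i ∈ A)
    (R' : G → F → Prop) (hR' : ∀ k ∈ A, ∃ f, R' k f)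
    (hc : ∀ k ∈ A, ∀ k' ∈ A, ∀ f, R' k f → R' k' f → (k * k'⁻¹) * c = c * (k * k'⁻¹)) :
    ∃ M : Subgroup G, M.FiniteIndex ∧
      ∀ h ∈ A, h ∈ M → ∀ g : G, h * (g * c * g⁻¹) = g * c * g⁻¹ * h := by
  have h1 : ∀ i, ∃ M : Subgroup G, M.Normal ∧ M.FiniteIndex ∧
      ∀ g ∈ profiniteClosure A, g ∈ M → (t i)⁻¹ * g * t i ∈ profiniteClosure A := by
    intro i
    obtain ⟨M, hM, hM', h⟩ := exists_mem_profiniteClosure (K := A)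
      (D := A.comap (MulAut.conj (t i)⁻¹).toMonoidHom) (R i) (hR i) (by
        intro k hk k' hk' f hf hf'
        simpa using hA i k hk k' hk' f hf hf')
    refine ⟨M, hM, hM', fun g hg hgM N hN hN' => ?_⟩
    have h2 := h g hg hgM N hN hN'
    rw [Subgroup.mem_sup_of_normal_right] at h2 ⊢
    obtain ⟨k, hk, m, hm, rfl⟩ := h2
    refine ⟨(t i)⁻¹ * k * t i, by simpa using hk, (t i)⁻¹ * m * t i, ?_, by group⟩
    simpa using hN.conj_mem m hm (t i)⁻¹
  choose M hM hM' h using h1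
  obtain ⟨M₀, hM₀, hM₀', h₀⟩ := exists_mem_profiniteClosure (K := A)
    (D := Subgroup.centralizer {c}) R' hR' (by
      intro k hk k' hk' f hf hf'
      rw [Subgroup.mem_centralizer_singleton_iff]
      exact hc k hk k' hk' f hf hf')
  have hn : (⨅ i, M i).Normal := Subgroup.normal_iInf_normal hM
  have hf : (⨅ i, M i).FiniteIndex := Subgroup.finiteIndex_iInf hM'
  have hnorm : (M₀ ⊓ ⨅ i, M i).Normal := inferInstance
  refine ⟨M₀ ⊓ ⨅ i, M i, inferInstance, fun k hk hkM g => ?_⟩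
  -- `B` is stable under conjugation by the generators, hence by all of `G`, although `A` itself is
  -- only commensurated. It also lies in the closure of the centralizer of `c`.
  set B : Set G := profiniteClosure A ∩ (M₀ ⊓ ⨅ i, M i : Subgroup G) with hB
  have hstep : ∀ i, ∀ b ∈ B, (t i)⁻¹ * b * t i ∈ B := by
    rintro i b ⟨hb, hbM⟩
    refine ⟨h i b hb (Subgroup.mem_iInf.1 hbM.2 i), ?_⟩
    simpa using hnorm.conj_mem b hbM (t i)⁻¹
  have hconj : ∀ g, ∀ b ∈ B, g⁻¹ * b * g ∈ B := by
    intro g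
    have hg : g ∈ Subgroup.closure (Set.range t) := ht ▸ Subgroup.mem_top g
    induction hg using Subgroup.closure_induction_left with
    | one => simp
    | mul_left x hx y hy ih =>
      obtain ⟨i, rfl⟩ := hx
      intro b hb
      have := ih _ (hstep i b hb)
      rwa [show (t i * y)⁻¹ * b * (t i * y) = y⁻¹ * ((t i)⁻¹ * b * t i) * y by group]
    | inv_mul_cancel x hx y hy ih =>
      obtain ⟨i, rfl⟩ := hx
      obtain ⟨j, hj⟩ := hinv i
      intro b hb
      rw [← hj]
      have := ih _ (hstep j b hb)
      rwa [show (t j * y)⁻¹ * b * (t j * y) = y⁻¹ * ((t j)⁻¹ * b * t j) * y by group]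
  have hkB : k ∈ B := ⟨fun N _ _ => Subgroup.mem_sup_left hk, hkM⟩
  have hgk := hconj g k hkB
  have h3 := profiniteClosure_centralizer (h₀ _ hgk.1 hgk.2.1)
  calc k * (g * c * g⁻¹) = g * (g⁻¹ * k * g * c) * g⁻¹ := by group
    _ = g * (c * (g⁻¹ * k * g)) * g⁻¹ := by rw [h3]
    _ = g * c * g⁻¹ * k := by group

end ProfiniteTopology

/-! ### The fundamental group of `DeltaD` -/

namespace Signed

variable {E : Type*}

@[simp] theorem inv_inv (e : Signed E) : e.inv.inv = e := by simp [inv]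

theorem toFree_inv (e : Signed E) : e.inv.toFree = e.toFree⁻¹ := by
  simp [toFree, inv, FreeGroup.inv_mk, FreeGroup.invRev]

end Signed

namespace DeltaD

/-- The element of the fundamental group given by an element of the vertical free group. -/
def vertHom : FreeGroup VLoop →* DeltaD.FundamentalGroup :=
  (PresentedGroup.mk _).comp (FreeGroup.map Sum.inl)

/-- The element of the fundamental group given by an element of the horizontal free group. -/
def horHom : FreeGroup HLoop →* DeltaD.FundamentalGroup :=
  (PresentedGroup.mk _).comp (FreeGroup.map Sum.inr)

/-- The element of the fundamental group given by an oriented vertical loop. -/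
def vert (s : Signed VLoop) : DeltaD.FundamentalGroup := vertHom s.toFree

/-- The element of the fundamental group given by an oriented horizontal loop. -/
def hor (z : Signed HLoop) : DeltaD.FundamentalGroup := horHom z.toFree

theorem vert_inv (s : Signed VLoop) : vert s.inv = (vert s)⁻¹ := by
  rw [vert, Signed.toFree_inv, map_inv, vert]

theorem hor_inv (z : Signed HLoop) : hor z.inv = (hor z)⁻¹ := by
  rw [hor, Signed.toFree_inv, map_inv, hor]

theorem vert_mul_hor_tile (q : Fin 4) :
    vert (DeltaD.tile q).left * hor (DeltaD.tile q).top =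
      hor (DeltaD.tile q).bottom * vert (DeltaD.tile q).right := by
  have h : PresentedGroup.mk (Set.range DeltaD.boundary) (DeltaD.boundary q) = 1 :=
    PresentedGroup.one_of_mem ⟨q, rfl⟩
  rw [VHComplex.boundary, map_mul, map_mul, map_inv, map_mul, map_inv, mul_inv_eq_one,
    mul_inv_eq_iff_eq_mul] at h
  exact h

theorem vert_mul_hor_view (p : Fin 4 × Bool × Bool) :
    vert (DeltaD.view p).left * hor (DeltaD.view p).top =
      hor (DeltaD.view p).bottom * vert (DeltaD.view p).right := by
  have hV : ∀ c : Tile VLoop HLoop, vert c.left * hor c.top = hor c.bottom * vert c.right →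
      vert c.flipV.left * hor c.flipV.top = hor c.flipV.bottom * vert c.flipV.right := by
    intro c h
    simp only [Tile.flipV, vert_inv]
    rw [inv_mul_eq_iff_eq_mul, ← mul_assoc, eq_mul_inv_iff_mul_eq, h]
  have hH : ∀ c : Tile VLoop HLoop, vert c.left * hor c.top = hor c.bottom * vert c.right →
      vert c.flipH.left * hor c.flipH.top = hor c.flipH.bottom * vert c.flipH.right := by
    intro c h
    simp only [Tile.flipH, hor_inv]
    rw [mul_inv_eq_iff_eq_mul, mul_assoc, eq_inv_mul_iff_mul_eq, h]
  obtain ⟨q, i, j⟩ := p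
  have h := vert_mul_hor_tile q
  cases i <;> cases j
  · exact h
  · exact hH _ h
  · exact hV _ h
  · exact hH _ (hV _ h)

theorem vert_mul_hor (s : Signed VLoop) (z : Signed HLoop) :
    vert s * hor z = hor (stepD s z).1 * vert (stepD s z).2 := by
  obtain ⟨p, ⟨rfl, rfl⟩, -⟩ := DeltaD_isComplete s z
  rw [stepD_view, vert_mul_hor_view]

/-- Group form of the triviality of cubes: the three copies of `s` return `z` to itself and all turn
into the same `t`. -/
theorem vert_pow_three_mul_hor (s : Signed VLoop) (z : Signed HLoop) :
    ∃ t, vert s ^ 3 * hor z = hor z * vert t ^ 3 := by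
  have h : ∀ s z, ∃ t, (stepD s z).2 = t ∧ (stepD s (stepD s z).1).2 = t ∧
      (stepD s (stepD s (stepD s z).1).1) = (z, t) := by decide +kernel
  obtain ⟨t, h1, h2, h3⟩ := h s z
  refine ⟨t, ?_⟩
  rw [pow_three, mul_assoc, mul_assoc, vert_mul_hor, h1, ← mul_assoc (vert s) (hor _),
    vert_mul_hor, h2, ← mul_assoc, ← mul_assoc, vert_mul_hor, h3, pow_three]
  simp only [mul_assoc]

/-- The horizontal subgroup of the fundamental group. -/
def horSubgroup : Subgroup DeltaD.FundamentalGroup := Subgroup.closure (Set.range hor)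

theorem hor_mem (z : Signed HLoop) : hor z ∈ horSubgroup := Subgroup.subset_closure ⟨z, rfl⟩

theorem horSubgroup_induction {P : DeltaD.FundamentalGroup → Prop} (one : P 1)
    (mul : ∀ z, ∀ h ∈ horSubgroup, P h → P (hor z * h)) : ∀ h ∈ horSubgroup, P h := by
  intro h hh
  induction hh using Subgroup.closure_induction_left with
  | one => exact one
  | mul_left x hx y hy ih =>
    obtain ⟨z, rfl⟩ := hx
    exact mul z y hy ih
  | inv_mul_cancel x hx y hy ih =>
    obtain ⟨z, rfl⟩ := hx
    rw [← hor_inv]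
    exact mul _ y hy ih

theorem exists_vert_mul (h : DeltaD.FundamentalGroup) (hh : h ∈ horSubgroup) :
    ∀ s, ∃ t, ∃ h' ∈ horSubgroup, vert s * h = h' * vert t := by
  revert h
  refine horSubgroup_induction (fun s => ⟨s, 1, one_mem _, by simp⟩) ?_
  intro z h _ ih s
  obtain ⟨t, h', hh', e⟩ := ih (stepD s z).2
  refine ⟨t, hor (stepD s z).1 * h', mul_mem (hor_mem _) hh', ?_⟩
  rw [← mul_assoc, vert_mul_hor, mul_assoc, e, mul_assoc]

theorem exists_vert_pow_three_mul (h : DeltaD.FundamentalGroup) (hh : h ∈ horSubgroup) :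
    ∀ s, ∃ t, vert s ^ 3 * h = h * vert t ^ 3 := by
  revert h
  refine horSubgroup_induction (fun s => ⟨s, by simp⟩) ?_
  intro z h _ ih s
  obtain ⟨t, e⟩ := vert_pow_three_mul_hor s z
  obtain ⟨t', e'⟩ := ih t
  exact ⟨t', by rw [← mul_assoc, e, mul_assoc, e', mul_assoc]⟩

theorem closure_vert_hor : Subgroup.closure (Set.range (Sum.elim vert hor)) = ⊤ := by
  rw [eq_top_iff, ← PresentedGroup.closure_range_of, Subgroup.closure_le]
  rintro _ ⟨v | h, rfl⟩
  · refine Subgroup.subset_closure ⟨.inl (v, true), ?_⟩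
    simp only [Sum.elim_inl, vert, vertHom, Signed.toFree, MonoidHom.comp_apply]
    rfl
  · refine Subgroup.subset_closure ⟨.inr (h, true), ?_⟩
    simp only [Sum.elim_inr, hor, horHom, Signed.toFree, MonoidHom.comp_apply]
    rfl

/-- The vertical letter emerging on the right takes finitely many values. It labels the cosets both
for commensuration by vertical letters and for centralizing the cube. -/
theorem exists_finiteIndex_commute_conj [Group.ResiduallyFinite DeltaD.FundamentalGroup]
    (s : Signed VLoop) :
    ∃ M : Subgroup DeltaD.FundamentalGroup, M.FiniteIndex ∧ ∀ h ∈ horSubgroup, h ∈ M →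
      ∀ g, h * (g * vert s ^ 3 * g⁻¹) = g * vert s ^ 3 * g⁻¹ * h := by
  refine exists_normal_commute_conj (F := Signed VLoop) horSubgroup (vert s ^ 3)
    (Sum.elim vert hor) closure_vert_hor ?_
    -- For a horizontal generator the condition is vacuous, since it normalizes the horizontal
    -- subgroup.
    (fun i k t => ∃ h' ∈ horSubgroup, ∀ s, i = .inl s → vert s.inv * k = h' * vert t) ?_ ?_
    (fun k t => vert s ^ 3 * k = k * vert t ^ 3) ?_ ?_
  · rintro (s | z)
    · exact ⟨.inl s.inv, vert_inv s⟩
    · exact ⟨.inr z.inv, hor_inv z⟩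
  · rintro (s | z) k hk
    · obtain ⟨t, h', hh', e⟩ := exists_vert_mul k hk s.inv
      refine ⟨t, h', hh', ?_⟩
      rintro _ ⟨⟩
      exact e
    · exact ⟨s, 1, one_mem _, by simp⟩
  · rintro (s | z) k hk k' hk' t ⟨h, hh, e⟩ ⟨h', hh', e'⟩
    · have e := e s rfl
      have e' := e' s rfl
      rw [vert_inv] at e e'
      have : (vert s)⁻¹ * (k * k'⁻¹) * vert s = (vert s)⁻¹ * k * ((vert s)⁻¹ * k')⁻¹ := by group
      simp only [Sum.elim_inl]
      rw [this, e, e', mul_inv_rev, mul_assoc, mul_inv_cancel_left]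
      exact mul_mem hh (inv_mem hh')
    · exact mul_mem (mul_mem (inv_mem (hor_mem z)) (mul_mem hk (inv_mem hk'))) (hor_mem z)
  · exact fun k hk => exists_vert_pow_three_mul k hk s
  · intro k hk k' hk' t e e'
    calc k * k'⁻¹ * vert s ^ 3 = k * k'⁻¹ * (vert s ^ 3 * k') * k'⁻¹ := by group
      _ = k * vert t ^ 3 * k'⁻¹ := by rw [e']; group
      _ = vert s ^ 3 * (k * k'⁻¹) := by rw [← e]; group

/-! ### The action on the vertical free group -/

/-- The action of an oriented vertical loop on the products of an oriented horizontal loop and an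
element of the vertical free group. -/
def moveLoop (s : Signed VLoop) : Equiv.Perm (Signed HLoop × FreeGroup VLoop) where
  toFun c := ((stepD s c.1).1, (stepD s c.1).2.toFree * c.2)
  invFun c := ((stepD s.inv c.1).1, (stepD s.inv c.1).2.toFree * c.2)
  left_inv c := by
    have h : ∀ s z, stepD (Signed.inv s) (stepD s z).1 = (z, (stepD s z).2.inv) := by decide
    simp [h, Signed.toFree_inv]
  right_inv c := by
    have h : ∀ s z, stepD s (stepD (Signed.inv s) z).1 = (z, (stepD s.inv z).2.inv) := by decide
    simp [h, Signed.toFree_inv]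

theorem moveLoop_inv (s : Signed VLoop) : moveLoop s.inv = (moveLoop s)⁻¹ := by
  ext1 c
  simp [moveLoop]

/-- The action of the vertical free group on the products of an oriented horizontal loop and an
element of the vertical free group. -/
def move : FreeGroup VLoop →* Equiv.Perm (Signed HLoop × FreeGroup VLoop) :=
  FreeGroup.lift fun v => moveLoop (v, true)

theorem move_toFree (s : Signed VLoop) : move s.toFree = moveLoop s := by
  obtain ⟨v, _ | _⟩ := s
  · simpa [move, Signed.toFree, FreeGroup.lift_mk, Signed.inv] using (moveLoop_inv (v, true)).symm
  · simp [move, Signed.toFree, FreeGroup.lift_mk]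

/-- If `g * z = w * k` for oriented horizontal loops `z` and `w`, then `k` is the section of `g`
at `z`. -/
def sect (z : Signed HLoop) (g : FreeGroup VLoop) : FreeGroup VLoop := (move g (z, 1)).2

theorem move_mul_right (g : FreeGroup VLoop) (z : Signed HLoop) (k m : FreeGroup VLoop) :
    move g (z, k * m) = ((move g (z, k)).1, (move g (z, k)).2 * m) := by
  let ρ : Equiv.Perm (Signed HLoop × FreeGroup VLoop) :=
    (Equiv.refl _).prodCongr (Equiv.mulRight m)
  have h : Commute (move g) ρ := by
    induction g using FreeGroup.induction_on with
    | C1 => rw [map_one]; exact Commute.one_left ρ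
    | of v =>
      ext1 c
      simp [move, moveLoop, ρ, mul_assoc]
    | inv_of v ih => rw [map_inv]; exact ih.inv_left
    | mul g g' h h' => rw [map_mul]; exact h.mul_left h'
  exact congrArg (fun σ : Equiv.Perm (Signed HLoop × FreeGroup VLoop) => σ (z, k)) h

theorem sect_mul_toFree (z : Signed HLoop) (g : FreeGroup VLoop) (s : Signed VLoop) :
    sect z (g * s.toFree) = sect (stepD s z).1 g * (stepD s z).2.toFree := by
  have := move_mul_right g (stepD s z).1 1 (stepD s z).2.toFree
  rw [one_mul] at this
  rw [sect, map_mul, move_toFree, Equiv.Perm.mul_apply, sect]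
  simp only [moveLoop, Equiv.coe_fn_mk, mul_one, this]

@[simp] theorem sect_one (z : Signed HLoop) : sect z 1 = 1 := by simp [sect]

theorem toFree_mul_mk (s : Signed VLoop) (L : List (Signed VLoop)) :
    FreeGroup.mk (s :: L) = s.toFree * FreeGroup.mk L := by
  rw [Signed.toFree, FreeGroup.mul_mk, List.singleton_append]

theorem mk_append_toFree (s : Signed VLoop) (L : List (Signed VLoop)) :
    FreeGroup.mk (L ++ [s]) = FreeGroup.mk L * s.toFree := by
  rw [Signed.toFree, FreeGroup.mul_mk]

/-- The relation `g z = w k` can be rewritten as `k z⁻¹ = w⁻¹ g`; hence the section at `z⁻¹` undoes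
the section at `z`. -/
theorem move_sect (z : Signed HLoop) (g : FreeGroup VLoop) :
    move (sect z g) (z.inv, 1) = ((move g (z, 1)).1.inv, g) := by
  obtain ⟨L, rfl⟩ : ∃ L, g = FreeGroup.mk L := ⟨g.toWord, FreeGroup.mk_toWord.symm⟩
  induction L with
  | nil =>
    have : FreeGroup.mk ([] : List (Signed VLoop)) = 1 := rfl
    simp [this]
  | cons s L ih =>
    have h : ∀ s z, stepD (stepD s z).2 (Signed.inv z) = ((stepD s z).1.inv, s) := by decide
    have h1 : move (FreeGroup.mk (s :: L)) (z, 1) = moveLoop s (move (FreeGroup.mk L) (z, 1)) := by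
      rw [toFree_mul_mk, map_mul, move_toFree, Equiv.Perm.mul_apply]
    rw [sect] at ih ⊢
    rw [h1]
    simp only [moveLoop, Equiv.coe_fn_mk]
    rw [map_mul, move_toFree, Equiv.Perm.mul_apply, ih, toFree_mul_mk]
    simp only [moveLoop, Equiv.coe_fn_mk, h]

theorem sect_inv_sect (z : Signed HLoop) (g : FreeGroup VLoop) : sect z.inv (sect z g) = g :=
  congrArg Prod.snd (move_sect z g)

/-- The permutation `sect z`. -/
def sectPerm (z : Signed HLoop) : Equiv.Perm (FreeGroup VLoop) where
  toFun := sect z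
  invFun := sect z.inv
  left_inv := sect_inv_sect z
  right_inv g := by simpa using sect_inv_sect z.inv g

theorem sectPerm_inv (z : Signed HLoop) : sectPerm z.inv = (sectPerm z)⁻¹ :=
  Equiv.ext fun _ => rfl

/-- The generators of the fundamental group act on the vertical free group. -/
def actLoop : VLoop ⊕ HLoop → Equiv.Perm (FreeGroup VLoop)
  | .inl v => Equiv.mulRight (FreeGroup.of v)⁻¹
  | .inr h => sectPerm (h, false)

theorem lift_actLoop_vert (g : FreeGroup VLoop) :
    FreeGroup.lift actLoop (FreeGroup.map Sum.inl g) = Equiv.mulRight g⁻¹ := by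
  induction g using FreeGroup.induction_on with
  | C1 => simp
  | of v => simp [actLoop]
  | inv_of v _ => simp [actLoop]
  | mul g g' h h' => simp [h, h', Equiv.mulRight_mul]

theorem lift_actLoop_hor (z : Signed HLoop) :
    FreeGroup.lift actLoop (FreeGroup.map Sum.inr z.toFree) = sectPerm z.inv := by
  obtain ⟨h, _ | _⟩ := z
  · simp [Signed.toFree, FreeGroup.lift_mk, actLoop, ← sectPerm_inv]
  · simp [Signed.toFree, FreeGroup.lift_mk, actLoop, Signed.inv]

/-- The action of the fundamental group on the vertical free group. -/
def action : DeltaD.FundamentalGroup →* Equiv.Perm (FreeGroup VLoop) :=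
  -- This models right cosets of the horizontal subgroup, with group elements multiplying on the
  -- right by their inverses. After inversion, the relation `s z = w t` becomes the cocycle identity
  -- `sect_mul_toFree`.
  PresentedGroup.toGroup (f := actLoop) (by
    rintro _ ⟨q, rfl⟩
    rw [VHComplex.boundary, map_mul, map_mul, map_inv, map_mul, map_inv, mul_inv_eq_one,
      mul_inv_eq_iff_eq_mul, lift_actLoop_vert, lift_actLoop_vert, lift_actLoop_hor,
      lift_actLoop_hor, sectPerm_inv, sectPerm_inv, ← inv_inj]
    ext1 g
    have h : DeltaD.view (q, false, false) = DeltaD.tile q := rfl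
    have h1 := stepD_view (q, false, false)
    have h2 := sect_mul_toFree (DeltaD.tile q).top g (DeltaD.tile q).left
    rw [h] at h1
    rw [h1] at h2
    simpa [sectPerm] using h2)

theorem action_vertHom (g k : FreeGroup VLoop) : action (vertHom g) k = k * g⁻¹ := by
  have : action (vertHom g) = FreeGroup.lift actLoop (FreeGroup.map Sum.inl g) := rfl
  rw [this, lift_actLoop_vert]
  rfl

theorem action_hor (z : Signed HLoop) : action (hor z) = (sectPerm z)⁻¹ :=
  (lift_actLoop_hor z).trans (sectPerm_inv z)

/-- In a product `g z` the last letter of `g` meets `z` first, so the dual automaton reads `g`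
backwards. -/
theorem sect_mk_reverse (z : Signed HLoop) (u : List (Signed VLoop)) :
    sect z (FreeGroup.mk u.reverse) = FreeGroup.mk (mealyD.dual.act z u).reverse := by
  induction u generalizing z with
  | nil => exact sect_one z
  | cons s u ih =>
    rw [List.reverse_cons, mk_append_toFree, sect_mul_toFree, ih]
    simp only [Mealy.act, List.reverse_cons, mk_append_toFree]
    rfl

/-- If the outputs of two adjacent letters cancel, then so do the letters themselves; this is a
finite check. -/
theorem isReduced_dual_act (z : Signed HLoop) {u : List (Signed VLoop)}
    (hu : FreeGroup.IsReduced u) : FreeGroup.IsReduced (mealyD.dual.act z u) := by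
  induction u generalizing z with
  | nil => exact hu
  | cons s u ih =>
    cases u with
    | nil => exact FreeGroup.IsReduced.singleton
    | cons t u =>
      rw [FreeGroup.isReduced_cons_cons] at hu
      have h : ∀ (s t : Signed VLoop) (z : Signed HLoop), (s.1 = t.1 → s.2 = t.2) →
          (stepD s z).2.1 = (stepD t (stepD s z).1).2.1 →
          (stepD s z).2.2 = (stepD t (stepD s z).1).2.2 := by decide +kernel
      have h' := ih (stepD s z).1 hu.2
      rw [Mealy.act] at h' ⊢
      exact FreeGroup.isReduced_cons_cons.2 ⟨h s t z hu.1, h'⟩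

theorem isReduced_dual_run (v : List (Signed HLoop)) {u : List (Signed VLoop)}
    (hu : FreeGroup.IsReduced u) : FreeGroup.IsReduced (mealyD.dual.run v u) := by
  induction v generalizing u with
  | nil => exact hu
  | cons z v ih => exact ih (isReduced_dual_act z hu)

end DeltaD

/-! ### Reduced conjugates of `a³` and unbounded odometer orbits -/

namespace AlternatingWords

theorem isReduced_word (v : VLoop) (w : List (ZMod 2)) : FreeGroup.IsReduced (word v w) := by
  induction w generalizing v with
  | nil => exact FreeGroup.IsReduced.nil
  | cons i w ih =>
    cases w with
    | nil => exact FreeGroup.IsReduced.singleton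
    | cons j w =>
      refine FreeGroup.isReduced_cons_cons.2 ⟨fun h => ?_, ih (other v)⟩
      cases v <;> cases h

/-- The reduced word `u a³ u⁻¹` for an alternating word `u` of even length that starts with `a`. -/
theorem isReduced_conj_cube (w : List (ZMod 2)) (hw : Even w.length) :
    FreeGroup.IsReduced (word .a w ++ [(.a, true), (.a, true), (.a, true)] ++
      FreeGroup.invRev (word .a w)) := by
  have hoth : other^[w.length] .a = .a := by
    obtain ⟨m, hm⟩ := hw
    rw [hm, ← two_mul, Function.iterate_mul]
    exact Function.iterate_fixed rfl m
  have h0 := isReduced_word .a (w ++ [0])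
  -- With `u` of even length, both `u a` and `u a⁻¹` alternate. Inverting the second gives the
  -- reduced word `a u⁻¹`, and the pieces are glued along the letter `a`.
  have h1 := isReduced_word .a (w ++ [1])
  rw [word_append, hoth] at h0 h1
  have h2 : FreeGroup.IsReduced ([(.a, true)] ++ FreeGroup.invRev (word .a w)) := by
    rw [FreeGroup.isReduced_iff_reduce_eq] at h1 ⊢
    have := congrArg FreeGroup.invRev h1
    rw [← FreeGroup.reduce_invRev] at this
    simpa [FreeGroup.invRev, word, sign] using this
  have h3 : FreeGroup.IsReduced ([(VLoop.a, true)] ++ [(.a, true), (.a, true)]) := by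
    simp [FreeGroup.isReduced_cons_cons, FreeGroup.IsReduced.singleton]
  have h4 := FreeGroup.IsReduced.append_overlap (L₁ := word .a w) (L₂ := [(.a, true)]) h0 h3
    (by simp)
  have h5 := FreeGroup.IsReduced.append_overlap (L₁ := word .a w ++ [(.a, true), (.a, true)])
    (L₂ := [(.a, true)]) (by simpa using h4) h2 (by simp)
  simpa using h5

/-- Otherwise orbits on words of length `2 * n` would have at most `n` elements, whereas the
odometer is transitive on `2 ^ (2 * n)` of them. -/
theorem exists_iterate_ne (n : ℕ) (hn : 0 < n) :
    ∃ w : List (ZMod 2), Even w.length ∧ (mealyD.dual.run odometer)^[n] (word .a w) ≠ word .a w := by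
  by_contra! h
  have key : ∀ f : Fin (2 * n) → ZMod 2, ∃ k : Fin n,
      (mealyD.dual.run odometer)^[k] (word .a (List.replicate (2 * n) 0)) =
        word .a (List.ofFn f) := by
    intro f
    obtain ⟨k, hk⟩ := exists_iterate_eq (List.replicate (2 * n) 0) (List.ofFn f) (by simp)
    have hp : Function.IsPeriodicPt (mealyD.dual.run odometer) n
        (word .a (List.replicate (2 * n) 0)) := h _ (by simp)
    exact ⟨⟨k % n, Nat.mod_lt _ hn⟩, by rw [← hk]; exact hp.iterate_mod_apply k⟩
  choose F hF using key
  have hinj : Function.Injective F := by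
    intro f g hfg
    have := hF f
    rw [hfg, hF g] at this
    exact List.ofFn_injective (word_injective _ this).symm
  have := Fintype.card_le_of_injective F hinj
  simp only [Fintype.card_pi, ZMod.card, Finset.prod_const, Finset.card_univ,
    Fintype.card_fin] at this
  have h2 : 2 * n < 2 ^ (2 * n) := Nat.lt_two_pow_self
  omega

end AlternatingWords

open DeltaD AlternatingWords in
/-- The fundamental group of `DeltaD` is not residually finite. -/
theorem not_residuallyFinite : ¬ Group.ResiduallyFinite DeltaD.FundamentalGroup := by
  intro hRF
  obtain ⟨M, hM, hcomm⟩ := exists_finiteIndex_commute_conj (.a, true)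
  let h : DeltaD.FundamentalGroup := hor (.x, false) * hor (.y, true)
  have hh : h ∈ horSubgroup := mul_mem (hor_mem _) (hor_mem _)
  obtain ⟨n, hn, -, hnM⟩ := Subgroup.exists_pow_mem_of_index_ne_zero hM.index_ne_zero h
  have haction : ∀ (k : ℕ) (u : List (Signed VLoop)), (action (h ^ k))⁻¹ (FreeGroup.mk u.reverse) =
      FreeGroup.mk ((mealyD.dual.run odometer)^[k] u).reverse := by
    intro k
    induction k with
    | zero => simp
    | succ k ih =>
      intro u
      rw [pow_succ', map_mul, mul_inv_rev, Equiv.Perm.mul_apply, Function.iterate_succ_apply, ← ih]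
      congr 1
      simp only [h, map_mul, mul_inv_rev, Equiv.Perm.mul_apply, action_hor, inv_inv, sectPerm,
        Equiv.coe_fn_mk, sect_mk_reverse]
      rfl
  obtain ⟨w, hw, hne⟩ := exists_iterate_ne n hn
  apply hne
  set W := word .a w
  set u := W ++ [(.a, true), (.a, true), (.a, true)] ++ FreeGroup.invRev W with hu
  have hred : FreeGroup.IsReduced u := isReduced_conj_cube w hw
  have hmk : FreeGroup.mk u.reverse = (FreeGroup.mk W.reverse)⁻¹ *
      (Signed.toFree (VLoop.a, true)) ^ 3 * ((FreeGroup.mk W.reverse)⁻¹)⁻¹ := by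
    simp [hu, FreeGroup.inv_mk, FreeGroup.invRev, Signed.toFree, pow_three, FreeGroup.mul_mk,
      Function.comp_def]
  -- The element `h ^ n` fixes `1` and commutes with the vertical element `u a³ u⁻¹`, which
  -- translates `1` to that element; so `h ^ n` fixes it.
  have hfix : (action (h ^ n))⁻¹ (FreeGroup.mk u.reverse) = FreeGroup.mk u.reverse := by
    have h1 := hcomm _ (pow_mem hh n) hnM (vertHom (FreeGroup.mk W.reverse)⁻¹)
    have h2 : vertHom (FreeGroup.mk W.reverse)⁻¹ * vert (.a, true) ^ 3 *
        (vertHom (FreeGroup.mk W.reverse)⁻¹)⁻¹ = vertHom (FreeGroup.mk u.reverse) := by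
      rw [hmk, map_mul, map_mul, map_pow, map_inv _ ((FreeGroup.mk W.reverse)⁻¹)]
      rfl
    rw [h2] at h1
    have h3 := congrArg (fun g => (action g)⁻¹ 1) h1
    have h4 : ∀ k, (action (vertHom (FreeGroup.mk u.reverse)))⁻¹ k =
        k * FreeGroup.mk u.reverse := by
      intro k
      rw [← map_inv, ← map_inv, action_vertHom, inv_inv]
    have h5 : (action (h ^ n))⁻¹ 1 = 1 := by
      have h6 := haction n []
      rwa [Mealy.iterate_run, List.eq_nil_of_length_eq_zero (Mealy.length_run _ _ [])] at h6
    simp only [map_mul, mul_inv_rev, Equiv.Perm.mul_apply, h4, h5, one_mul] at h3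
    exact h3.symm
  rw [haction, Mealy.iterate_run] at hfix
  have h1 := congrArg FreeGroup.toWord hfix
  have hrev : ∀ {L : List (Signed VLoop)}, FreeGroup.IsReduced L →
      FreeGroup.IsReduced L.reverse := by
    intro L hL
    unfold FreeGroup.IsReduced at hL ⊢
    rw [List.isChain_reverse]
    exact hL.imp fun a b hab hba => (hab hba.symm).symm
  rw [FreeGroup.toWord_mk, FreeGroup.toWord_mk, (hrev (isReduced_dual_run _ hred)).reduce_eq,
    (hrev hred).reduce_eq, List.reverse_inj] at h1
  -- Both sides are reduced, so equality in the free group is equality of words, and it restricts to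
  -- the prefix `W`.
  have h2 := congrArg (List.take W.length) h1
  rw [← Mealy.run_take] at h2
  rw [Mealy.iterate_run]
  simpa [hu] using h2

/-- The fundamental group of `DeltaD` is not residually finite; its automaton `A` is bireversible,
`G_A` is isomorphic to `C₃ * C₃`, and the automaton group of the dual is free of rank two. -/
theorem mainTheorem3 :
    ¬ Group.ResiduallyFinite DeltaD.FundamentalGroup ∧
    ∃ hA : automatonD.IsBireversible,
      Nonempty (automatonD.AutomatonGroup hA.isInvertible ≃*
        Monoid.Coprod (Multiplicative (ZMod 3)) (Multiplicative (ZMod 3))) ∧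
      Nonempty (automatonD.dual.AutomatonGroup hA.dual_isInvertible ≃* FreeGroup (Fin 2)) := by
  refine ⟨not_residuallyFinite, ?_⟩
  rw [automatonD_eq]
  exact ⟨mealyD_isBireversible, nonempty_automatonGroup_mulEquiv_coprod _,
    nonempty_automatonGroup_dual_mulEquiv _⟩
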